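/- Consider the simply-typed $\lambda$-calculus with one base type $o$: types are $A ::= o \mid A \to A$, contexts are finite lists of types, and terms $\Gamma \vdash M : A$ are built from variables, abstraction and application. Fix an arbitrary set $\mathcal{C}$ (possibly empty or infinite), and write $\mathscr{M}_f(X)$ for the set of finite multisets over $X$. Let $\mathbf{Rel}$ be the Seely category of sets and relations ($\otimes$ and $\multimap$ given by the cartesian product of sets, the cartesian product $\&$ by disjoint union, $\top = \emptyset$, and $!X = \mathscr{M}_f(X)$ with its usual comonad structure). Let $\mathbf{ScottL}$ be the Seely category whose objects are preordered sets and whose morphisms from $A$ to $B$ are the relations $\alpha \subseteq A \times B$ that are down-closed in $A^{\mathrm{op}} \times B$, i.e. $(a,b) \in \alpha$, $a \leq_A a'$ and $b' \leq_B b$ imply $(a',b') \in \alpha$; composition is relational composition, and $\mathrm{id}_A = \{(a,a') \mid a' \leq_A a\}$. In it, $A \otimes B = A \times B$, $A \multimap B = A^{\mathrm{op}} \times B$, $A \,\&\, B = A + B$, $\top = \emptyset$, and $!A$ is $\mathscr{M}_f(A)$ with $\mu \leq_{!A} \nu$ iff every element of $\mu$ is $\leq_A$ some element of $\nu$; tensor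 of morphisms, pairing and currying are as in $\mathbf{Rel}$, projections and evaluation are the down-closures of those of $\mathbf{Rel}$, and \[ \begin{array}{rcl} !\alpha &=& \{(\mu,\nu) \mid \forall b \in \nu,\ \exists a \in \mu,\ (a,b) \in \alpha\},\\ \mathrm{der}_A &=& \{(\mu,a) \mid \exists a' \in \mu,\ a \leq_A a'\},\\ \mathrm{dig}_A &=& \{(\mu,[\mu_1,\dots,\mu_n]) \mid \forall i,\ \mu_i \leq_{!A} \mu\},\\ \mathsf{see}_{A_1,A_2} &=& \{((\mu_1,\mu_2),\nu) \mid \forall (i,a') \in \nu,\ \exists a \in \mu_i,\ a' \leq_{A_i} a\}. \end{array} \] Interpret the calculus in the standard way in the cartesian closed Kleisli categories $\mathbf{Rel}_!$ and $\mathbf{ScottL}_!$ (function space $A \Rightarrow B = {!A} \multimap B$, contexts interpreted by finite products), with $o$ interpreted as the set $\mathcal{C}$ in $\mathbf{Rel}_!$ and as $\mathcal{C}$ with the discrete preorder in $\mathbf{ScottL}_!$. Then types and contexts have the same underlying sets in both models, and a term $\Gamma \vdash M : A$ is interpreted as a relation $[\![M]\!]_{\mathbf{Rel}_!}$, respectively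 $[\![M]\!]_{\mathbf{ScottL}_!}$, from $\mathscr{M}_f([\![\Gamma]\!])$ to $[\![A]\!]$. Theorem. For every simply-typed $\lambda$-term $\Gamma \vdash M : A$, \[ [\![M]\!]_{\mathbf{ScottL}_!} \;=\; \bigl[\,[\![M]\!]_{\mathbf{Rel}_!}\,\bigr], \] where $[\,\cdot\,]$ is the down-closure in $(![\![\Gamma]\!])^{\mathrm{op}} \times [\![A]\!]$; that is, $(\mu,a) \in [\![M]\!]_{\mathbf{ScottL}_!}$ if and only if there is $(\mu',a') \in [\![M]\!]_{\mathbf{Rel}_!}$ with $\mu' \leq_{![\![\Gamma]\!]} \mu$ and $a \leq_{[\![A]\!]} a'$. -/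

import Mathlib

open scoped SetRel

universe u v w x

/-! ### The simply-typed `λ`-calculus over one base type -/

/-- Simple types: one base type `o` and arrow types. -/
inductive Ty : Type
  | base : Ty
  | arrow : Ty → Ty → Ty

/-- Typing contexts; the most recently bound variable comes first. -/
abbrev Ctx : Type := List Ty

/-- `Var Γ A`: the (de Bruijn) variables of type `A` in the context `Γ`. -/
inductive Var : Ctx → Ty → Type
  | here {Γ : Ctx} {A : Ty} : Var (A :: Γ) A
  | there {Γ : Ctx} {A B : Ty} : Var Γ A → Var (B :: Γ) A

/-- `Term Γ A`: the simply-typed `λ`-terms `Γ ⊢ M : A`. -/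
inductive Term : Ctx → Ty → Type
  | var {Γ : Ctx} {A : Ty} : Var Γ A → Term Γ A
  | lam {Γ : Ctx} {A B : Ty} : Term (A :: Γ) B → Term Γ (Ty.arrow A B)
  | app {Γ : Ctx} {A B : Ty} : Term Γ (Ty.arrow A B) → Term Γ A → Term Γ B

/-- The web of a simple type, the base type being interpreted by the set `C`:
`⟦o⟧ = C` and `⟦A → B⟧ = !⟦A⟧ ⊸ ⟦B⟧ = M_f(⟦A⟧) × ⟦B⟧`. -/
def Ty.web (C : Type u) : Ty → Type u
  | .base => C
  | .arrow A B => Multiset (Ty.web C A) × Ty.web C B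

/-- The web of a context: `⟦⟧ = ⊤ = ∅` and `⟦Γ, A⟧ = ⟦Γ⟧ & ⟦A⟧ = ⟦Γ⟧ + ⟦A⟧`. -/
def Ctx.web (C : Type u) : Ctx → Type u
  | [] => PEmpty
  | A :: Γ => Ctx.web C Γ ⊕ Ty.web C A

/-! ### The Seely category `Rel` of sets and relations

A morphism from `X` to `Y` is a relation `SetRel X Y`; identities and composition are Mathlib's
`SetRel.id` and `R ○ S` (first `R`, then `S`). On objects: `X ⊗ Y = X ⊸ Y = X × Y`,
`X & Y = X ⊕ Y`, `⊤ = ∅` and `! X = Multiset X`. -/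

namespace RelModel

variable {X : Type u} {Y : Type v} {Z : Type w} {W : Type x}

/-- Functorial action of the tensor product. -/
def tensor (R : SetRel X Z) (S : SetRel Y W) : SetRel (X × Y) (Z × W) :=
  {p | (p.1.1, p.2.1) ∈ R ∧ (p.1.2, p.2.2) ∈ S}

/-- First projection `X & Y → X`. -/
def fst : SetRel (X ⊕ Y) X := {p | p.1 = Sum.inl p.2}

/-- Second projection `X & Y → Y`. -/
def snd : SetRel (X ⊕ Y) Y := {p | p.1 = Sum.inr p.2}

/-- Pairing `Z → X & Y`. -/
def pair (R : SetRel Z X) (S : SetRel Z Y) : SetRel Z (X ⊕ Y) :=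
  {p | (∃ a, p.2 = Sum.inl a ∧ (p.1, a) ∈ R) ∨ (∃ b, p.2 = Sum.inr b ∧ (p.1, b) ∈ S)}

/-- Currying, from `Z ⊗ X → Y` to `Z → (X ⊸ Y)`. -/
def curry (R : SetRel (Z × X) Y) : SetRel Z (X × Y) :=
  {p | ((p.1, p.2.1), p.2.2) ∈ R}

/-- Evaluation `(X ⊸ Y) ⊗ X → Y`. -/
def ev : SetRel ((X × Y) × X) Y := {p | p.1.1 = (p.1.2, p.2)}

/-- Functorial action of `!`: the pairs `([a₁, …, aₙ], [b₁, …, bₙ])` with `(aᵢ, bᵢ) ∈ R`. -/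
def bangMap (R : SetRel X Y) : SetRel (Multiset X) (Multiset Y) :=
  {p | Multiset.Rel (fun a b => (a, b) ∈ R) p.1 p.2}

/-- Dereliction `! X → X`. -/
def der : SetRel (Multiset X) X := {p | p.1 = {p.2}}

/-- Digging `! X → ! ! X`. -/
def dig : SetRel (Multiset X) (Multiset (Multiset X)) := {p | p.1 = p.2.sum}

/-- Seely morphism `! X ⊗ ! Y → ! (X & Y)`. -/
def see : SetRel (Multiset X × Multiset Y) (Multiset (X ⊕ Y)) :=
  {p | p.2 = p.1.1.map Sum.inl + p.1.2.map Sum.inr}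

/-- Inverse of the Seely morphism. -/
def seeInv : SetRel (Multiset (X ⊕ Y)) (Multiset X × Multiset Y) := SetRel.inv see

/-- Composition in the Kleisli category of `!`, in diagrammatic order: first `R`, then `S`. -/
def kcomp (R : SetRel (Multiset X) Y) (S : SetRel (Multiset Y) Z) : SetRel (Multiset X) Z :=
  dig ○ bangMap R ○ S

/-- First Kleisli projection. -/
def kfst : SetRel (Multiset (X ⊕ Y)) X := der ○ fst

/-- Second Kleisli projection. -/
def ksnd : SetRel (Multiset (X ⊕ Y)) Y := der ○ snd

/-- Kleisli currying, with function space `X ⇒ Y = ! X ⊸ Y`. -/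
def kcurry (R : SetRel (Multiset (Z ⊕ X)) Y) : SetRel (Multiset Z) (Multiset X × Y) :=
  curry (see ○ R)

/-- Kleisli evaluation `(X ⇒ Y) & X → Y`. -/
def kev : SetRel (Multiset ((Multiset X × Y) ⊕ X)) Y :=
  seeInv ○ tensor der SetRel.id ○ ev

end RelModel

/-- Interpretation of variables in the cartesian closed category `Rel_!`. -/
def Var.rel (C : Type u) : {Γ : Ctx} → {A : Ty} → Var Γ A →
    SetRel (Multiset (Ctx.web C Γ)) (Ty.web C A)
  | _, _, .here => RelModel.ksnd
  | _, _, .there x => RelModel.kcomp RelModel.kfst (Var.rel C x)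

/-- Interpretation of terms in the cartesian closed category `Rel_!`. -/
def Term.rel (C : Type u) : {Γ : Ctx} → {A : Ty} → Term Γ A →
    SetRel (Multiset (Ctx.web C Γ)) (Ty.web C A)
  | _, _, .var x => Var.rel C x
  | _, _, .lam M => RelModel.kcurry (Term.rel C M)
  | _, _, .app M N => RelModel.kcomp (RelModel.pair (Term.rel C M) (Term.rel C N)) RelModel.kev

/-! ### The Seely category `ScottL` of preorders and down-closed relations

An object is a set `X` together with a preorder `P : PreorderOn X`. -/

namespace ScottL

/-- A preorder on the set `X`. This is Mathlib's `Preorder X` as a plain structure rather than a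
class: the preorders needed on multisets and on products are not the ones that instance resolution
finds. -/
structure PreorderOn (X : Type u) where
  le : X → X → Prop
  le_refl : ∀ a, le a a
  le_trans : ∀ a b c, le a b → le b c → le a c

variable {X : Type u} {Y : Type v} {Z : Type w} {W : Type x}

/-- The discrete preorder. -/
def discrete (X : Type u) : PreorderOn X where
  le a b := a = b
  le_refl _ := rfl
  le_trans _ _ _ := Eq.trans

/-- `P ⊗ Q`: the product preorder. -/
def tensorObj (P : PreorderOn X) (Q : PreorderOn Y) : PreorderOn (X × Y) where
  le p q := P.le p.1 q.1 ∧ Q.le p.2 q.2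
  le_refl p := ⟨P.le_refl p.1, Q.le_refl p.2⟩
  le_trans _ _ _ h k := ⟨P.le_trans _ _ _ h.1 k.1, Q.le_trans _ _ _ h.2 k.2⟩

/-- `P ⊸ Q = Pᵒᵖ × Q`. -/
def lolli (P : PreorderOn X) (Q : PreorderOn Y) : PreorderOn (X × Y) where
  le p q := P.le q.1 p.1 ∧ Q.le p.2 q.2
  le_refl p := ⟨P.le_refl p.1, Q.le_refl p.2⟩
  le_trans _ _ _ h k := ⟨P.le_trans _ _ _ k.1 h.1, Q.le_trans _ _ _ h.2 k.2⟩

/-- `P & Q`: the disjoint union of preorders. -/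
def withObj (P : PreorderOn X) (Q : PreorderOn Y) : PreorderOn (X ⊕ Y) where
  le := Sum.LiftRel P.le Q.le
  le_refl
    | .inl a => .inl (P.le_refl a)
    | .inr b => .inr (Q.le_refl b)
  le_trans
    | _, _, _, .inl h, .inl k => .inl (P.le_trans _ _ _ h k)
    | _, _, _, .inr h, .inr k => .inr (Q.le_trans _ _ _ h k)

/-- `! P`: finite multisets, with `μ ≤ ν` iff every element of the support of `μ` is below some
element of the support of `ν`. -/
def bang (P : PreorderOn X) : PreorderOn (Multiset X) where
  le μ ν := ∀ a ∈ μ, ∃ a' ∈ ν, P.le a a'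
  le_refl _ a ha := ⟨a, ha, P.le_refl a⟩
  le_trans _ _ _ h k a ha :=
    let ⟨b, hb, hab⟩ := h a ha
    let ⟨c, hc, hbc⟩ := k b hb
    ⟨c, hc, P.le_trans _ _ _ hab hbc⟩

/-- The down-closure `[S]` of a subset `S` of a preordered set. -/
def downClosure (P : PreorderOn X) (S : Set X) : Set X := {a | ∃ b ∈ S, P.le a b}

/-- Morphisms of `ScottL` from `P` to `Q`: the relations that are down-closed in `Pᵒᵖ × Q`. -/
structure Hom (P : PreorderOn X) (Q : PreorderOn Y) where
  rel : SetRel X Y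
  down : ∀ {a a' b b'}, (a, b) ∈ rel → P.le a a' → Q.le b' b → (a', b') ∈ rel

variable {P : PreorderOn X} {Q : PreorderOn Y} {T : PreorderOn Z} {U : PreorderOn W}

/-- The down-closure of a relation, as a morphism of `ScottL`. -/
def Hom.closure (P : PreorderOn X) (Q : PreorderOn Y) (R : SetRel X Y) : Hom P Q where
  rel := downClosure (lolli P Q) R
  down := fun ⟨c, hc, h1, h2⟩ ha hb =>
    ⟨c, hc, P.le_trans _ _ _ h1 ha, Q.le_trans _ _ _ hb h2⟩

/-- Identities. -/
def id (P : PreorderOn X) : Hom P P where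
  rel := {p | P.le p.2 p.1}
  down h ha hb := P.le_trans _ _ _ hb (P.le_trans _ _ _ h ha)

/-- Composition, in diagrammatic order: first `f`, then `g`. -/
def comp (f : Hom P Q) (g : Hom Q T) : Hom P T where
  rel := f.rel ○ g.rel
  down := fun ⟨c, h1, h2⟩ ha hb =>
    ⟨c, f.down h1 ha (Q.le_refl c), g.down h2 (Q.le_refl c) hb⟩

/-- Functorial action of the tensor product, as in `Rel`. -/
def tensor (f : Hom P T) (g : Hom Q U) : Hom (tensorObj P Q) (tensorObj T U) where
  rel := RelModel.tensor f.rel g.rel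
  down h ha hb := ⟨f.down h.1 ha.1 hb.1, g.down h.2 ha.2 hb.2⟩

/-- First projection: the down-closure of that of `Rel`. -/
def fst (P : PreorderOn X) (Q : PreorderOn Y) : Hom (withObj P Q) P :=
  Hom.closure _ _ RelModel.fst

/-- Second projection: the down-closure of that of `Rel`. -/
def snd (P : PreorderOn X) (Q : PreorderOn Y) : Hom (withObj P Q) Q :=
  Hom.closure _ _ RelModel.snd

/-- Pairing, as in `Rel`. -/
def pair (f : Hom T P) (g : Hom T Q) : Hom T (withObj P Q) where
  rel := RelModel.pair f.rel g.rel
  down := by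
    rintro a a' b b' (⟨c, hc, h⟩ | ⟨c, hc, h⟩) ha hb <;> cases hc <;> cases hb
    · exact Or.inl ⟨_, rfl, f.down h ha ‹_›⟩
    · exact Or.inr ⟨_, rfl, g.down h ha ‹_›⟩

/-- Currying, as in `Rel`. -/
def curry (f : Hom (tensorObj T P) Q) : Hom T (lolli P Q) where
  rel := RelModel.curry f.rel
  down h ha hb := f.down h ⟨ha, hb.1⟩ hb.2

/-- Evaluation: the down-closure of that of `Rel`. -/
def ev (P : PreorderOn X) (Q : PreorderOn Y) : Hom (tensorObj (lolli P Q) P) Q :=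
  Hom.closure _ _ RelModel.ev

/-- Functorial action of `!`. -/
def bangMap (f : Hom P Q) : Hom (bang P) (bang Q) where
  rel := {p | ∀ b ∈ p.2, ∃ a ∈ p.1, (a, b) ∈ f.rel}
  down h ha hb b hbm :=
    let ⟨c, hc, hbc⟩ := hb b hbm
    let ⟨d, hd, hdc⟩ := h c hc
    let ⟨e, he, hde⟩ := ha d hd
    ⟨e, he, f.down hdc hde hbc⟩

/-- Dereliction. -/
def der (P : PreorderOn X) : Hom (bang P) P where
  rel := {p | ∃ a' ∈ p.1, P.le p.2 a'}
  down := fun ⟨c, hc, h⟩ ha hb =>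
    let ⟨d, hd, hcd⟩ := ha c hc
    ⟨d, hd, P.le_trans _ _ _ hb (P.le_trans _ _ _ h hcd)⟩

/-- Digging. -/
def dig (P : PreorderOn X) : Hom (bang P) (bang (bang P)) where
  rel := {p | ∀ ν ∈ p.2, (bang P).le ν p.1}
  down h ha hb ν hν :=
    let ⟨ξ, hξ, hle⟩ := hb ν hν
    (bang P).le_trans _ _ _ hle ((bang P).le_trans _ _ _ (h ξ hξ) ha)

/-- Seely morphism `! P ⊗ ! Q → ! (P & Q)`. -/
def see (P : PreorderOn X) (Q : PreorderOn Y) :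
    Hom (tensorObj (bang P) (bang Q)) (bang (withObj P Q)) where
  rel := {p | (∀ a', Sum.inl a' ∈ p.2 → ∃ a ∈ p.1.1, P.le a' a) ∧
    (∀ b', Sum.inr b' ∈ p.2 → ∃ b ∈ p.1.2, Q.le b' b)}
  down := by
    rintro ⟨μ₁, μ₂⟩ ⟨μ₁', μ₂'⟩ ν ν' ⟨h1, h2⟩ ⟨k1, k2⟩ hν
    constructor
    · intro a ha
      obtain ⟨_, hc, hac⟩ := hν _ ha
      obtain ⟨hac⟩ | _ := hac
      obtain ⟨d, hd, hcd⟩ := h1 _ hc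
      obtain ⟨e, he, hde⟩ := k1 _ hd
      exact ⟨e, he, P.le_trans _ _ _ hac (P.le_trans _ _ _ hcd hde)⟩
    · intro b hb
      obtain ⟨_, hc, hbc⟩ := hν _ hb
      obtain _ | ⟨hbc⟩ := hbc
      obtain ⟨d, hd, hcd⟩ := h2 _ hc
      obtain ⟨e, he, hde⟩ := k2 _ hd
      exact ⟨e, he, Q.le_trans _ _ _ hbc (Q.le_trans _ _ _ hcd hde)⟩

/-- Inverse of the Seely morphism: the down-closure of that of `Rel`. -/
def seeInv (P : PreorderOn X) (Q : PreorderOn Y) :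
    Hom (bang (withObj P Q)) (tensorObj (bang P) (bang Q)) :=
  Hom.closure _ _ RelModel.seeInv

/-- Composition in the Kleisli category of `!`, in diagrammatic order: first `f`, then `g`. -/
def kcomp (f : Hom (bang P) Q) (g : Hom (bang Q) T) : Hom (bang P) T :=
  comp (comp (dig P) (bangMap f)) g

/-- First Kleisli projection. -/
def kfst (P : PreorderOn X) (Q : PreorderOn Y) : Hom (bang (withObj P Q)) P :=
  comp (der _) (fst P Q)

/-- Second Kleisli projection. -/
def ksnd (P : PreorderOn X) (Q : PreorderOn Y) : Hom (bang (withObj P Q)) Q :=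
  comp (der _) (snd P Q)

/-- Kleisli currying, with function space `P ⇒ Q = ! P ⊸ Q`. -/
def kcurry (f : Hom (bang (withObj T P)) Q) : Hom (bang T) (lolli (bang P) Q) :=
  curry (comp (see T P) f)

/-- Kleisli evaluation `(P ⇒ Q) & P → Q`. -/
def kev (P : PreorderOn X) (Q : PreorderOn Y) : Hom (bang (withObj (lolli (bang P) Q) P)) Q :=
  comp (comp (seeInv _ _) (tensor (der _) (id _))) (ev (bang P) Q)

end ScottL

/-- Interpretation of types in `ScottL_!`: the base type is the discrete preorder on `C`, and
`⟦A → B⟧ = !⟦A⟧ ⊸ ⟦B⟧`. -/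
def Ty.scott (C : Type u) : (A : Ty) → ScottL.PreorderOn (Ty.web C A)
  | .base => ScottL.discrete C
  | .arrow A B => ScottL.lolli (ScottL.bang (Ty.scott C A)) (Ty.scott C B)

/-- Interpretation of contexts in `ScottL_!`: `⟦⟧ = ⊤` and `⟦Γ, A⟧ = ⟦Γ⟧ & ⟦A⟧`. -/
def Ctx.scott (C : Type u) : (Γ : Ctx) → ScottL.PreorderOn (Ctx.web C Γ)
  | [] => ScottL.discrete PEmpty
  | A :: Γ => ScottL.withObj (Ctx.scott C Γ) (Ty.scott C A)

/-- Interpretation of variables in the cartesian closed category `ScottL_!`. -/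
def Var.scott (C : Type u) : {Γ : Ctx} → {A : Ty} → Var Γ A →
    ScottL.Hom (ScottL.bang (Ctx.scott C Γ)) (Ty.scott C A)
  | _, _, .here => ScottL.ksnd _ _
  | _, _, .there x => ScottL.kcomp (ScottL.kfst _ _) (Var.scott C x)

/-- Interpretation of terms in the cartesian closed category `ScottL_!`. -/
def Term.scott (C : Type u) : {Γ : Ctx} → {A : Ty} → Term Γ A →
    ScottL.Hom (ScottL.bang (Ctx.scott C Γ)) (Ty.scott C A)
  | _, _, .var x => Var.scott C x
  | _, _, .lam M => ScottL.kcurry (Term.scott C M)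
  | _, _, .app M N =>
      ScottL.kcomp (ScottL.pair (Term.scott C M) (Term.scott C N)) (ScottL.kev _ _)

/-!
A morphism `R` of `Rel_!` or `ScottL_!` acts on subsets by `s ↦ R(!s)`, where `!s` is the set of
finite multisets of elements of `s`, and so does a subset of a function space, regarded as a
relation. In both models this action turns composition, pairing, currying and evaluation into the
same set-theoretic operations, except that `ScottL` adds down-closures. The theorem thus asks that
application commute with down-closure. That fails for arbitrary subsets, but a logical relation
singles out those for which it holds hereditarily. Down-closed subsets are among them, and
down-closed relations are determined by their action on down-closed subsets, so this suffices.
-/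

namespace RelModel

variable {X : Type u} {Y : Type v} {Z : Type w} {W : Type x}

/-! ### Actions on subsets in `Rel` -/

/-- The set `!s` of finite multisets of elements of `s`: the promotion of `s`, regarded as a
morphism `⊤ → X` of `Rel_!`. -/
def bangSet (s : Set X) : Set (Multiset X) := {m | ∀ a ∈ m, a ∈ s}

/-- The disjoint union of two subsets: the pairing of `s` and `t`, regarded as morphisms `⊤ → X`
and `⊤ → Y` of `Rel_!`. It is encoded so that its preimages along `Sum.inl` and `Sum.inr` are
definitionally `s` and `t`. -/
def disjSum (s : Set X) (t : Set Y) : Set (X ⊕ Y) := {c | Sum.elim (· ∈ s) (· ∈ t) c}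

/-- The action `s ↦ R(!s)` of a morphism of `Rel_!` on subsets. As a morphism `X → Y` of `Rel_!`
has the same graph as an element of the function space `X ⇒ Y`, this is also the application of a
subset of `X ⇒ Y` to a subset of `X`. -/
def kimage (R : SetRel (Multiset X) Y) (s : Set X) : Set Y := R.image (bangSet s)

theorem image_tensor (R : SetRel X Z) (S : SetRel Y W) (s : Set X) (t : Set Y) :
    (tensor R S).image (s ×ˢ t) = R.image s ×ˢ S.image t := by
  ext ⟨c, d⟩
  constructor
  · rintro ⟨⟨a, b⟩, ⟨ha, hb⟩, hac, hbd⟩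
    exact ⟨⟨a, ha, hac⟩, ⟨b, hb, hbd⟩⟩
  · rintro ⟨⟨a, ha, hac⟩, ⟨b, hb, hbd⟩⟩
    exact ⟨(a, b), ⟨ha, hb⟩, hac, hbd⟩

theorem image_fst (s : Set (X ⊕ Y)) : fst.image s = Sum.inl ⁻¹' s := by
  ext; simp [fst]

theorem image_snd (s : Set (X ⊕ Y)) : snd.image s = Sum.inr ⁻¹' s := by
  ext; simp [snd]

theorem image_pair (R : SetRel Z X) (S : SetRel Z Y) (s : Set Z) :
    (pair R S).image s = disjSum (R.image s) (S.image s) := by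
  ext (a | b) <;> simp [pair, disjSum]

theorem image_image_curry (R : SetRel (Z × X) Y) (s : Set Z) (t : Set X) :
    SetRel.image ((curry R).image s) t = R.image (s ×ˢ t) := by
  ext b
  constructor
  · rintro ⟨a, ha, c, hc, h⟩
    exact ⟨(c, a), ⟨hc, ha⟩, h⟩
  · rintro ⟨⟨c, a⟩, ⟨hc, ha⟩, h⟩
    exact ⟨a, ha, c, hc, h⟩

theorem image_ev (R : SetRel X Y) (s : Set X) : ev.image (R ×ˢ s) = R.image s := by
  ext b
  constructor
  · rintro ⟨⟨_, a⟩, ⟨hR, ha⟩, h⟩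
    exact ⟨a, ha, h ▸ hR⟩
  · rintro ⟨a, ha, hR⟩
    exact ⟨((a, b), a), ⟨hR, ha⟩, rfl⟩

theorem image_bangMap (R : SetRel X Y) (s : Set X) :
    (bangMap R).image (bangSet s) = bangSet (R.image s) := by
  ext ν
  constructor
  · rintro ⟨μ, hμ, hR⟩ b hb
    obtain ⟨a, ha, hab⟩ := Multiset.exists_mem_of_rel_of_mem (Multiset.rel_flip.2 hR) hb
    exact ⟨a, hμ a ha, hab⟩
  · intro hν
    induction ν using Multiset.induction_on with
    | empty => exact ⟨0, by simp [bangSet], Multiset.Rel.zero⟩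
    | cons b ν ih =>
      obtain ⟨hb, hν⟩ := Multiset.forall_mem_cons.1 hν
      obtain ⟨a, ha, hab⟩ := hb
      obtain ⟨μ, hμ, hR⟩ := ih hν
      exact ⟨a ::ₘ μ, Multiset.forall_mem_cons.2 ⟨ha, hμ⟩, Multiset.Rel.cons hab hR⟩

theorem image_der (s : Set X) : der.image (bangSet s) = s := by
  ext; simp [der, bangSet]

theorem sum_mem_bangSet {s : Set X} {ξ : Multiset (Multiset X)} :
    ξ.sum ∈ bangSet s ↔ ξ ∈ bangSet (bangSet s) := by
  change (∀ a ∈ ξ.join, a ∈ s) ↔ ∀ μ ∈ ξ, ∀ a ∈ μ, a ∈ s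
  simp only [Multiset.mem_join]
  grind

theorem image_dig (s : Set X) : dig.image (bangSet s) = bangSet (bangSet s) := by
  ext ξ
  simp [dig, sum_mem_bangSet]

theorem disjSum_mem_bangSet {u : Set (X ⊕ Y)} {μ : Multiset X} {ν : Multiset Y} :
    μ.disjSum ν ∈ bangSet u ↔ μ ∈ bangSet (Sum.inl ⁻¹' u) ∧ ν ∈ bangSet (Sum.inr ⁻¹' u) := by
  simp [bangSet]

theorem exists_eq_disjSum (ξ : Multiset (X ⊕ Y)) :
    ∃ (μ : Multiset X) (ν : Multiset Y), ξ = μ.disjSum ν := by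
  induction ξ using Multiset.induction_on with
  | empty => exact ⟨0, 0, rfl⟩
  | cons c ξ ih =>
    obtain ⟨μ, ν, rfl⟩ := ih
    rcases c with a | b
    · exact ⟨a ::ₘ μ, ν, by simp [Multiset.disjSum]⟩
    · exact ⟨μ, b ::ₘ ν, by simp [Multiset.disjSum]⟩

theorem image_see (s : Set X) (t : Set Y) :
    see.image (bangSet s ×ˢ bangSet t) = bangSet (disjSum s t) := by
  ext ξ
  constructor
  · rintro ⟨⟨μ, ν⟩, h, hξ⟩
    exact Set.mem_of_eq_of_mem hξ (disjSum_mem_bangSet.2 h)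
  · intro hξ
    obtain ⟨μ, ν, rfl⟩ := exists_eq_disjSum ξ
    exact ⟨(μ, ν), disjSum_mem_bangSet.1 hξ, rfl⟩

theorem image_seeInv (u : Set (X ⊕ Y)) :
    seeInv.image (bangSet u) = bangSet (Sum.inl ⁻¹' u) ×ˢ bangSet (Sum.inr ⁻¹' u) := by
  ext ⟨μ, ν⟩
  constructor
  · rintro ⟨ξ, hξ, h⟩
    exact disjSum_mem_bangSet.1 (Set.mem_of_eq_of_mem h.symm hξ)
  · intro h
    exact ⟨μ.disjSum ν, disjSum_mem_bangSet.2 h, rfl⟩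

theorem kimage_kcomp (R : SetRel (Multiset X) Y) (S : SetRel (Multiset Y) Z) (s : Set X) :
    kimage (kcomp R S) s = kimage S (kimage R s) := by
  simp only [kimage, kcomp, SetRel.image_comp, image_dig, image_bangMap]

theorem kimage_kfst (s : Set (X ⊕ Y)) : kimage kfst s = Sum.inl ⁻¹' s := by
  simp only [kimage, kfst, SetRel.image_comp, image_der, image_fst]

theorem kimage_ksnd (s : Set (X ⊕ Y)) : kimage ksnd s = Sum.inr ⁻¹' s := by
  simp only [kimage, ksnd, SetRel.image_comp, image_der, image_snd]

theorem kimage_pair (R : SetRel (Multiset Z) X) (S : SetRel (Multiset Z) Y) (s : Set Z) :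
    kimage (pair R S) s = disjSum (kimage R s) (kimage S s) :=
  image_pair R S (bangSet s)

theorem kimage_kimage_kcurry (R : SetRel (Multiset (Z ⊕ X)) Y) (s : Set Z) (t : Set X) :
    kimage (kimage (kcurry R) s) t = kimage R (disjSum s t) := by
  simp only [kimage, kcurry, image_image_curry, SetRel.image_comp, image_see]

theorem kimage_kev (u : Set ((Multiset X × Y) ⊕ X)) :
    kimage kev u = kimage (Sum.inl ⁻¹' u) (Sum.inr ⁻¹' u) := by
  simp only [kimage, kev, SetRel.image_comp, image_seeInv, image_tensor, image_der,
    SetRel.image_id, image_ev]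

end RelModel

namespace ScottL

open RelModel (bangSet disjSum kimage)

variable {X : Type u} {Y : Type v} {Z : Type w}
variable {P : PreorderOn X} {Q : PreorderOn Y} {T : PreorderOn Z}

/-! ### Actions on subsets in `ScottL` -/

theorem image_id (s : Set X) : (id P).rel.image s = downClosure P s :=
  rfl

theorem downClosure_downClosure (P : PreorderOn X) (s : Set X) :
    downClosure P (downClosure P s) = downClosure P s := by
  ext a
  constructor
  · rintro ⟨b, ⟨c, hc, hbc⟩, hab⟩
    exact ⟨c, hc, P.le_trans _ _ _ hab hbc⟩
  · intro ha
    exact ⟨a, ha, P.le_refl a⟩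

theorem downClosure_prod (s : Set X) (t : Set Y) :
    downClosure (tensorObj P Q) (s ×ˢ t) = downClosure P s ×ˢ downClosure Q t :=
  RelModel.image_tensor (id P).rel (id Q).rel s t

theorem preimage_inl_downClosure (u : Set (X ⊕ Y)) :
    Sum.inl ⁻¹' downClosure (withObj P Q) u = downClosure P (Sum.inl ⁻¹' u) := by
  ext; simp [downClosure, withObj]

theorem preimage_inr_downClosure (u : Set (X ⊕ Y)) :
    Sum.inr ⁻¹' downClosure (withObj P Q) u = downClosure Q (Sum.inr ⁻¹' u) := by
  ext; simp [downClosure, withObj]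

theorem downClosure_disjSum (s : Set X) (t : Set Y) :
    downClosure (withObj P Q) (disjSum s t) = disjSum (downClosure P s) (downClosure Q t) := by
  ext (a | b) <;> simp [downClosure, withObj, disjSum]

theorem Hom.image_downClosure (f : Hom P Q) (s : Set X) :
    f.rel.image (downClosure P s) = f.rel.image s := by
  ext b
  constructor
  · rintro ⟨a, ⟨a', ha', haa'⟩, hab⟩
    exact ⟨a', ha', f.down hab haa' (Q.le_refl b)⟩
  · rintro ⟨a, ha, hab⟩
    exact ⟨a, ⟨a, ha, P.le_refl a⟩, hab⟩

theorem Hom.downClosure_image (f : Hom P Q) (s : Set X) :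
    downClosure Q (f.rel.image s) = f.rel.image s := by
  ext b
  constructor
  · rintro ⟨b', ⟨a, ha, hab'⟩, hbb'⟩
    exact ⟨a, ha, f.down hab' (P.le_refl a) hbb'⟩
  · intro hb
    exact ⟨b, hb, Q.le_refl b⟩

theorem Hom.downClosure_rel (f : Hom P Q) : downClosure (lolli P Q) f.rel = f.rel := by
  ext ⟨a, b⟩
  constructor
  · rintro ⟨⟨a', b'⟩, h, ha, hb⟩
    exact f.down h ha hb
  · intro h
    exact ⟨(a, b), h, (lolli P Q).le_refl _⟩

theorem image_downClosure_lolli (R : SetRel X Y) (s : Set X) :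
    SetRel.image (downClosure (lolli P Q) R) s = downClosure Q (R.image (downClosure P s)) := by
  ext b
  constructor
  · rintro ⟨a, ha, ⟨a', b'⟩, h, ha', hb⟩
    exact ⟨b', ⟨a', ⟨a, ha, ha'⟩, h⟩, hb⟩
  · rintro ⟨b', ⟨a', ⟨a, ha, ha'⟩, h⟩, hb⟩
    exact ⟨a, ha, (a', b'), h, ha', hb⟩

theorem image_bangMap (f : Hom P Q) (s : Set X) :
    (bangMap f).rel.image (bangSet s) = bangSet (f.rel.image s) := by
  apply Set.Subset.antisymm
  · rintro ν ⟨μ, hμ, h⟩ b hb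
    obtain ⟨a, ha, hab⟩ := h b hb
    exact ⟨a, hμ a ha, hab⟩
  · rw [← RelModel.image_bangMap]
    refine SetRel.image_subset_image_left ?_
    rintro ⟨μ, ν⟩ h b hb
    exact Multiset.exists_mem_of_rel_of_mem (Multiset.rel_flip.2 h) hb

theorem downClosure_bangSet (s : Set X) :
    downClosure (bang P) (bangSet s) = bangSet (downClosure P s) :=
  image_bangMap (id P) s

theorem image_der (s : Set X) : (der P).rel.image (bangSet s) = downClosure P s := by
  ext a
  constructor
  · rintro ⟨μ, hμ, a', ha', h⟩
    exact ⟨a', hμ a' ha', h⟩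
  · rintro ⟨a', ha', h⟩
    exact ⟨{a'}, by simpa [bangSet] using ha', a', Multiset.mem_singleton_self a', h⟩

theorem image_dig (s : Set X) :
    (dig P).rel.image (bangSet s) = bangSet (bangSet (downClosure P s)) := by
  ext ξ
  rw [← downClosure_bangSet]
  constructor
  · rintro ⟨μ, hμ, h⟩ ν hν
    exact ⟨μ, hμ, h ν hν⟩
  · rw [downClosure_bangSet, ← RelModel.sum_mem_bangSet, ← downClosure_bangSet]
    rintro ⟨μ, hμ, hle⟩
    exact ⟨μ, hμ, fun ν hν a ha => hle a (Multiset.mem_join.2 ⟨ν, hν, ha⟩)⟩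

theorem mem_see {μ : Multiset X} {ν : Multiset Y} {ξ : Multiset (X ⊕ Y)} :
    ((μ, ν), ξ) ∈ (see P Q).rel ↔ (bang (withObj P Q)).le ξ (μ.disjSum ν) := by
  simp [see, bang, withObj]

theorem image_see (s : Set X) (t : Set Y) :
    (see P Q).rel.image (bangSet s ×ˢ bangSet t) =
      bangSet (downClosure (withObj P Q) (disjSum s t)) := by
  rw [← downClosure_bangSet, ← RelModel.image_see]
  ext ξ
  constructor
  · rintro ⟨⟨μ, ν⟩, h, hξ⟩
    exact ⟨μ.disjSum ν, ⟨(μ, ν), h, rfl⟩, mem_see.1 hξ⟩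
  · rintro ⟨ξ', ⟨⟨μ, ν⟩, h, hξ'⟩, hξ⟩
    obtain rfl : ξ' = μ.disjSum ν := hξ'
    exact ⟨(μ, ν), h, mem_see.2 hξ⟩

theorem image_seeInv (u : Set (X ⊕ Y)) :
    (seeInv P Q).rel.image (bangSet u) =
      bangSet (downClosure P (Sum.inl ⁻¹' u)) ×ˢ bangSet (downClosure Q (Sum.inr ⁻¹' u)) := by
  rw [seeInv, Hom.closure, image_downClosure_lolli, downClosure_bangSet, RelModel.image_seeInv,
    downClosure_prod]
  simp only [downClosure_bangSet, preimage_inl_downClosure, preimage_inr_downClosure,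
    downClosure_downClosure]

theorem image_ev (R : SetRel X Y) (s : Set X) :
    (ev P Q).rel.image (R ×ˢ s) = SetRel.image (downClosure (lolli P Q) R) s := by
  rw [ev, Hom.closure, image_downClosure_lolli, downClosure_prod, RelModel.image_ev,
    image_downClosure_lolli, image_downClosure_lolli]
  simp only [downClosure_downClosure]

theorem Hom.kimage_downClosure (f : Hom (bang P) Q) (s : Set X) :
    kimage f.rel (downClosure P s) = kimage f.rel s := by
  rw [kimage, ← downClosure_bangSet, f.image_downClosure, kimage]

theorem Hom.downClosure_kimage (f : Hom (bang P) Q) (s : Set X) :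
    downClosure Q (kimage f.rel s) = kimage f.rel s :=
  f.downClosure_image _

theorem kimage_kcomp (f : Hom (bang P) Q) (g : Hom (bang Q) T) (s : Set X) :
    kimage (kcomp f g).rel s = kimage g.rel (kimage f.rel s) := by
  rw [← f.kimage_downClosure]
  simp only [kimage, kcomp, comp, SetRel.image_comp, image_dig, image_bangMap]

theorem kimage_kfst (s : Set (X ⊕ Y)) :
    kimage (kfst P Q).rel s = downClosure P (Sum.inl ⁻¹' s) := by
  simp only [kimage, kfst, comp, fst, Hom.closure, SetRel.image_comp, image_der,
    image_downClosure_lolli, RelModel.image_fst, downClosure_downClosure, preimage_inl_downClosure]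

theorem kimage_ksnd (s : Set (X ⊕ Y)) :
    kimage (ksnd P Q).rel s = downClosure Q (Sum.inr ⁻¹' s) := by
  simp only [kimage, ksnd, comp, snd, Hom.closure, SetRel.image_comp, image_der,
    image_downClosure_lolli, RelModel.image_snd, downClosure_downClosure, preimage_inr_downClosure]

theorem kimage_pair (f : Hom (bang T) P) (g : Hom (bang T) Q) (s : Set Z) :
    kimage (pair f g).rel s = disjSum (kimage f.rel s) (kimage g.rel s) :=
  RelModel.kimage_pair f.rel g.rel s

theorem kimage_kimage_kcurry (f : Hom (bang (withObj T P)) Q) (s : Set Z) (t : Set X) :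
    kimage (kimage (kcurry f).rel s) t = kimage f.rel (disjSum s t) := by
  rw [← f.kimage_downClosure]
  simp only [kimage, kcurry, curry, comp, RelModel.image_image_curry, SetRel.image_comp, image_see]

theorem kimage_kev (u : Set ((Multiset X × Y) ⊕ X)) :
    kimage (kev P Q).rel u =
      kimage (downClosure (lolli (bang P) Q) (Sum.inl ⁻¹' u)) (downClosure P (Sum.inr ⁻¹' u)) := by
  simp only [kimage, kev, comp, tensor, SetRel.image_comp, image_seeInv, RelModel.image_tensor,
    image_der, image_id, image_ev, downClosure_bangSet, downClosure_downClosure]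

theorem kimage_downClosure_lolli_bang (R : SetRel (Multiset X) Y) (s : Set X) :
    kimage (downClosure (lolli (bang P) Q) R) s = downClosure Q (kimage R (downClosure P s)) := by
  rw [kimage, image_downClosure_lolli, downClosure_bangSet, kimage]

theorem mem_downClosure_lolli_bang {R : SetRel (Multiset X) Y} {μ : Multiset X} {b : Y} :
    (μ, b) ∈ downClosure (lolli (bang P) Q) R ↔
      b ∈ downClosure Q (kimage R (downClosure P {a | a ∈ μ})) := by
  constructor
  · rintro ⟨⟨μ', b'⟩, h, hμ, hb⟩
    exact ⟨b', ⟨μ', hμ, h⟩, hb⟩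
  · rintro ⟨b', ⟨μ', hμ, h⟩, hb⟩
    exact ⟨(μ', b'), h, hμ, hb⟩

theorem downClosure_lolli_bang_eq {R S : SetRel (Multiset X) Y}
    (h : ∀ s, downClosure Q (kimage R (downClosure P s)) =
      downClosure Q (kimage S (downClosure P s))) :
    downClosure (lolli (bang P) Q) R = downClosure (lolli (bang P) Q) S := by
  ext ⟨μ, b⟩
  simp only [mem_downClosure_lolli_bang, h]

/-! ### The logical relation -/

/-- The logical relation at a function space, given those at its domain and codomain: the subsets
of `P ⇒ Q` whose application preserves adequacy and commutes with down-closure. Only the function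
is closed on the left-hand side, because a down-closed relation does not distinguish `t` from its
down-closure. -/
def arrowAdequate (P : PreorderOn X) (Q : PreorderOn Y) (D : Set (Set X)) (E : Set (Set Y)) :
    Set (SetRel (Multiset X) Y) :=
  {s | ∀ t ∈ D, kimage s t ∈ E ∧
    kimage (downClosure (lolli (bang P) Q) s) t = downClosure Q (kimage s t)}

/-- The logical relation at a product, componentwise. -/
def withAdequate (D : Set (Set X)) (E : Set (Set Y)) : Set (Set (X ⊕ Y)) :=
  {u | Sum.inl ⁻¹' u ∈ D ∧ Sum.inr ⁻¹' u ∈ E}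

/-- The logical relation between the morphisms of `Rel_!` and `ScottL_!`: `R` preserves adequacy,
and on adequate subsets `f` acts as `R` followed by down-closure. -/
def Collapses (D : Set (Set X)) (E : Set (Set Y)) (R : SetRel (Multiset X) Y)
    (f : Hom (bang P) Q) : Prop :=
  ∀ s ∈ D, kimage R s ∈ E ∧ kimage f.rel s = downClosure Q (kimage R s)

theorem downClosure_mem_arrowAdequate {E : Set (Set Y)} (hE : ∀ t, downClosure Q t ∈ E)
    (D : Set (Set X)) (s : SetRel (Multiset X) Y) :
    downClosure (lolli (bang P) Q) s ∈ arrowAdequate P Q D E := by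
  intro t _
  rw [downClosure_downClosure, kimage_downClosure_lolli_bang, downClosure_downClosure]
  exact ⟨hE _, rfl⟩

theorem downClosure_mem_withAdequate {D : Set (Set X)} {E : Set (Set Y)}
    (hD : ∀ s, downClosure P s ∈ D) (hE : ∀ t, downClosure Q t ∈ E) (u : Set (X ⊕ Y)) :
    downClosure (withObj P Q) u ∈ withAdequate D E := by
  rw [withAdequate, Set.mem_ofPred_eq, preimage_inl_downClosure, preimage_inr_downClosure]
  exact ⟨hD _, hE _⟩

namespace Collapses

variable {D : Set (Set X)} {E : Set (Set Y)} {F : Set (Set Z)}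
variable {R : SetRel (Multiset X) Y} {f : Hom (bang P) Q}

theorem kfst : Collapses (withAdequate D E) D RelModel.kfst (kfst P Q) := by
  intro u hu
  rw [RelModel.kimage_kfst, kimage_kfst]
  exact ⟨hu.1, rfl⟩

theorem ksnd : Collapses (withAdequate D E) E RelModel.ksnd (ksnd P Q) := by
  intro u hu
  rw [RelModel.kimage_ksnd, kimage_ksnd]
  exact ⟨hu.2, rfl⟩

theorem kcomp {S : SetRel (Multiset Y) Z} {g : Hom (bang Q) T} (hf : Collapses D E R f)
    (hg : Collapses E F S g) : Collapses D F (RelModel.kcomp R S) (kcomp f g) := by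
  intro s hs
  obtain ⟨hR, hfR⟩ := hf s hs
  rw [RelModel.kimage_kcomp, kimage_kcomp, hfR, g.kimage_downClosure]
  exact hg _ hR

theorem pair {S : SetRel (Multiset X) Z} {g : Hom (bang P) T} (hf : Collapses D E R f)
    (hg : Collapses D F S g) : Collapses D (withAdequate E F) (RelModel.pair R S) (pair f g) := by
  intro s hs
  obtain ⟨hR, hfR⟩ := hf s hs
  obtain ⟨hS, hgS⟩ := hg s hs
  rw [RelModel.kimage_pair, kimage_pair, hfR, hgS, downClosure_disjSum]
  exact ⟨⟨hR, hS⟩, rfl⟩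

theorem kev :
    Collapses (withAdequate (arrowAdequate P Q D E) D) E RelModel.kev (kev P Q) := by
  rintro u ⟨hl, hr⟩
  rw [RelModel.kimage_kev, kimage_kev]
  obtain ⟨hE, happ⟩ := hl _ hr
  exact ⟨hE, ((Hom.closure (bang P) Q _).kimage_downClosure _).trans happ⟩

theorem kimage_kcurry {R : SetRel (Multiset (X ⊕ Y)) Z} {f : Hom (bang (withObj P Q)) T}
    (hE : ∀ t, downClosure Q t ∈ E) (hf : Collapses (withAdequate D E) F R f) {s : Set X}
    (hs : s ∈ D) :
    kimage (kcurry f).rel s =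
      downClosure (lolli (bang Q) T) (kimage (RelModel.kcurry R) s) := by
  rw [← (kcurry f).downClosure_kimage]
  refine downClosure_lolli_bang_eq fun t => ?_
  rw [kimage_kimage_kcurry, RelModel.kimage_kimage_kcurry, f.downClosure_kimage]
  exact (hf (disjSum s (downClosure Q t)) ⟨hs, hE t⟩).2

theorem kcurry {R : SetRel (Multiset (X ⊕ Y)) Z} {f : Hom (bang (withObj P Q)) T}
    (hE : ∀ t, downClosure Q t ∈ E) (hf : Collapses (withAdequate D E) F R f) :
    Collapses D (arrowAdequate Q T E F) (RelModel.kcurry R) (kcurry f) := by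
  intro s hs
  have hcurry := hf.kimage_kcurry hE hs
  refine ⟨fun t ht => ?_, hcurry⟩
  rw [← hcurry, kimage_kimage_kcurry, RelModel.kimage_kimage_kcurry]
  exact hf _ ⟨hs, ht⟩

theorem rel_eq_downClosure (hD : ∀ s, downClosure P s ∈ D) (hf : Collapses D E R f) :
    f.rel = downClosure (lolli (bang P) Q) R := by
  rw [← f.downClosure_rel]
  refine downClosure_lolli_bang_eq fun s => ?_
  rw [f.downClosure_kimage]
  exact (hf _ (hD s)).2

end Collapses

end ScottL

/-- The logical relation at a simple type. -/
def Ty.adequate (C : Type u) : (A : Ty) → Set (Set (Ty.web C A))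
  | .base => Set.univ
  | .arrow A B => ScottL.arrowAdequate (Ty.scott C A) (Ty.scott C B) (Ty.adequate C A)
      (Ty.adequate C B)

/-- The logical relation at a context. -/
def Ctx.adequate (C : Type u) : (Γ : Ctx) → Set (Set (Ctx.web C Γ))
  | [] => Set.univ
  | A :: Γ => ScottL.withAdequate (Ctx.adequate C Γ) (Ty.adequate C A)

theorem Ty.downClosure_mem_adequate (C : Type u) :
    (A : Ty) → ∀ s, ScottL.downClosure (Ty.scott C A) s ∈ Ty.adequate C A
  | .base => fun _ => trivial
  | .arrow _ B => ScottL.downClosure_mem_arrowAdequate (Ty.downClosure_mem_adequate C B) _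

theorem Ctx.downClosure_mem_adequate (C : Type u) :
    (Γ : Ctx) → ∀ s, ScottL.downClosure (Ctx.scott C Γ) s ∈ Ctx.adequate C Γ
  | [] => fun _ => trivial
  | A :: Γ => ScottL.downClosure_mem_withAdequate (Ctx.downClosure_mem_adequate C Γ)
      (Ty.downClosure_mem_adequate C A)

theorem Var.collapses (C : Type u) {Γ : Ctx} {A : Ty} (x : Var Γ A) :
    ScottL.Collapses (Ctx.adequate C Γ) (Ty.adequate C A) (Var.rel C x) (Var.scott C x) := by
  induction x with
  | here => exact .ksnd
  | there x ih => exact .kcomp .kfst ih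

theorem Term.collapses (C : Type u) {Γ : Ctx} {A : Ty} (M : Term Γ A) :
    ScottL.Collapses (Ctx.adequate C Γ) (Ty.adequate C A) (Term.rel C M) (Term.scott C M) := by
  induction M with
  | var x => exact Var.collapses C x
  | lam M ih => exact ih.kcurry (Ty.downClosure_mem_adequate C _)
  | app M N ihM ihN => exact (ihM.pair ihN).kcomp .kev

theorem mainTheorem5 (C : Type u) (Γ : Ctx) (A : Ty) (M : Term Γ A) :
    (Term.scott C M).rel =
      ScottL.downClosure (ScottL.lolli (ScottL.bang (Ctx.scott C Γ)) (Ty.scott C A))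
        (Term.rel C M) :=
  (Term.collapses C M).rel_eq_downClosure (Ctx.downClosure_mem_adequate C Γ)
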